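/- Let $\omega=e^{2\pi i/3}$. For positive integers $k_1,\dots,k_n$ and $a_1,\dots,a_n\in\mathbb{Z}/3\mathbb{Z}$ with $k_1\ge 2$, or $k_1=1$ and $a_1\neq 0$, let $$L_*(k_1,\dots,k_n;a_1,\dots,a_n)=\sum_{m_1>\cdots>m_n>0}\frac{\omega^{a_1m_1+\cdots+a_nm_n}}{m_1^{k_1}\cdots m_n^{k_n}}$$ (the limit as $M\to\infty$ of the partial sums over $m_1<M$), and for $k_1\ge 2$ let $$\zeta_3(k_1,\dots,k_n;a_1,\dots,a_n)=\sum_{\substack{m_1>\cdots>m_n>0\\ m_i\equiv a_i\ (\mathrm{mod}\ 3)}}\frac{3^n}{m_1^{k_1}\cdots m_n^{k_n}}.$$ Write $\zeta^{(3)}$ for $L_*$, and in the arguments of both $\zeta^{(3)}$ and $\zeta_3$ write $k_i$, $\overline{k_i}$, $\widetilde{k_i}$ according as $a_i=0$, $1$, $2$; for example $\zeta^{(3)}(\overline{1},\widetilde{k-1})=L_*(1,k-1;1,2)$ and $\zeta_3(\overline{j},\widetilde{k-j})=\zeta_3(j,k-j;1,2)$. Let $\zeta$ be the Riemann zeta function.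 Then for every integer $k\ge 3$ all the series below converge, and $$\begin{aligned} \sum_{j=2}^{k-1}2^{j}\zeta_3(\overline{j},\widetilde{k-j})={}&(2\omega+4)\left(\zeta^{(3)}(\overline{1},k-1)-\zeta^{(3)}(\widetilde{1},\widetilde{k-1})\right)\\ &+(2\omega-2)\left(\zeta^{(3)}(\overline{1},\overline{k-1})-\zeta^{(3)}(\widetilde{1},k-1)\right)\\ &+(4\omega+2)\left(\zeta^{(3)}(\widetilde{1},\overline{k-1})-\zeta^{(3)}(\overline{1},\widetilde{k-1})\right)\\ &+(3k-3)\zeta(k)+(3k-3)\omega\,\zeta^{(3)}(\overline{k})-(3k-3)(\omega+1)\zeta^{(3)}(\widetilde{k}), \end{aligned}$$ $$\begin{aligned} \sum_{j=2}^{k-1}2^{j}\zeta_3(\widetilde{j},\overline{k-j})={}&(2\omega+4)\left(\zeta^{(3)}(\widetilde{1},k-1)-\zeta^{(3)}(\overline{1},\overline{k-1})\right)\\ &+(2\omega-2)\left(\zeta^{(3)}(\widetilde{1},\widetilde{k-1})-\zeta^{(3)}(\overline{1},k-1)\right)\\ &+(4\omega+2)\left(\zeta^{(3)}(\overline{1},\widetilde{k-1})-\zeta^{(3)}(\widetilde{1},\overline{k-1})\right)\\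 &+(3k-3)\zeta(k)+(3k-3)\omega\,\zeta^{(3)}(\widetilde{k})-(3k-3)(\omega+1)\zeta^{(3)}(\overline{k}). \end{aligned}$$ -/

import Mathlib

open Filter Topology

noncomputable section

/-- The primitive `N`th root of unity `ω = exp(2πi/N)`. -/
def levelRoot (N : ℕ) : ℂ :=
  Complex.exp (2 * (Real.pi : ℂ) * Complex.I / (N : ℂ))

/-- The partial sum of the stuffle-type multiple `L`-series of level `N` over
`M > m₁ > ⋯ > mₙ > 0`. An entry `(kᵢ, aᵢ)` of the list contributes the factor
`ω ^ (aᵢ mᵢ) / mᵢ ^ kᵢ`; the first entry belongs to the largest index `m₁`. -/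
def multipleLPartial (N : ℕ) : List (ℕ × ZMod N) → ℕ → ℂ
  | [], _ => 1
  | p :: t, M => ∑ m ∈ Finset.Ioo 0 M,
      levelRoot N ^ (p.2.val * m) / (m : ℂ) ^ p.1 * multipleLPartial N t m

/-- The series `∑_{m₁ > ⋯ > mₙ > 0}` converges, in the (possibly only conditional) sense that the
partial sums over `m₁ < M` converge as `M → ∞`. -/
def MultipleLConverges (N : ℕ) (s : List (ℕ × ZMod N)) : Prop :=
  ∃ z : ℂ, Tendsto (multipleLPartial N s) atTop (𝓝 z)

/-- The multiple `L`-value `L_*(k₁, …, kₙ; a₁, …, aₙ)` of level `N`, for the list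
`[(k₁, a₁), …, (kₙ, aₙ)]`; meaningful when `MultipleLConverges` holds. -/
def multipleL (N : ℕ) (s : List (ℕ × ZMod N)) : ℂ :=
  limUnder atTop (multipleLPartial N s)

/-- The partial sum over `M > m₁ > ⋯ > mₙ > 0`, `mᵢ ≡ aᵢ (mod N)`, of the series
`∑ N ^ n / (m₁ ^ k₁ ⋯ mₙ ^ kₙ)`. -/
def levelZetaPartial (N : ℕ) : List (ℕ × ZMod N) → ℕ → ℝ
  | [], _ => 1
  | p :: t, M => ∑ m ∈ (Finset.Ioo 0 M).filter (fun m : ℕ => (m : ZMod N) = p.2),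
      (N : ℝ) / (m : ℝ) ^ p.1 * levelZetaPartial N t m

/-- Convergence of the series of nonnegative terms defining a multiple zeta value of level `N`. -/
def LevelZetaConverges (N : ℕ) (s : List (ℕ × ZMod N)) : Prop :=
  ∃ x : ℝ, Tendsto (levelZetaPartial N s) atTop (𝓝 x)

/-- The multiple zeta value `ζ_N(k₁, …, kₙ; a₁, …, aₙ)` of level `N`, for the list
`[(k₁, a₁), …, (kₙ, aₙ)]`; meaningful when `LevelZetaConverges` holds. -/
def levelZeta (N : ℕ) (s : List (ℕ × ZMod N)) : ℝ :=
  limUnder atTop (levelZetaPartial N s)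

end

/-! Write the larger index as s = m + n. The conditions s ≡ 2c, m ≡ c (mod 3) become the symmetric
condition m ≡ n ≡ c, so the geometric sum of (2/(m+n))^j m^(-(k-j)) can be symmetrized in m and n.
Partial fractions collapse it to 2 m^(1-k) (1/(n-m) - 1/(n+m)) plus its mirror image, with a
correction on the diagonal (`weightedGeom_add_nat`). For fixed m, the reflection n ↦ 2m - n cancels
1/(n-m) over 0 < n < 2m, and shifting the remaining n turns the inner sum into that of (1_{u≡0} -
1_{u≡2c})/u over u > m (`shuffleInner_eq`). Expanding the indicators in powers of ω gives the double
L-values; the diagonal gives the depth-one terms.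

The sum over u converges only conditionally, so every rearrangement is made at a finite cutoff s <
M. The resulting truncation error tends to 0 by dominated convergence
(`tendsto_levelZetaPartial_sub_twistedPartial`), the majorant m^(-3/2) coming from the bound O(√m),
uniform in M, of `exists_abs_shuffleInner_le`. The Fourier step `twistedPartial_eq` is exact for
each M. -/

/-! ### Partial fractions for the symmetrized geometric sum -/

/-- The indicator function of a residue class modulo `3`. -/
def residueIndicator (c : ZMod 3) (m : ℕ) : ℝ := if (m : ZMod 3) = c then 1 else 0

/-- The function `1_{u ≡ 0} - 1_{u ≡ 2c}` modulo `3`. -/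
def residueDiff (c : ZMod 3) (u : ℕ) : ℝ := residueIndicator 0 u - residueIndicator (2 * c) u

/-- The weighted sum `∑ (2z)^j x^(K+2-j)` over `2 ≤ j ≤ K + 1`. -/
noncomputable def weightedGeom (K : ℕ) (z x : ℝ) : ℝ := ∑ i ∈ Finset.range K, (2 * z) ^ (i + 2) * x ^ (K - i)

/-- The summand into which the symmetrized weighted geometric sum splits. -/
noncomputable def shuffleKernel (K m n : ℕ) : ℝ :=
  (1 / (m : ℝ)) ^ (K + 1) * (1 / ((n : ℝ) - m) - 1 / ((n : ℝ) + m))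

theorem weightedGeom_succ (K : ℕ) (z x : ℝ) :
    weightedGeom (K + 1) z x = 2 * z * (weightedGeom K z x + 2 * z * x ^ (K + 1)) := by
  unfold weightedGeom
  rw [Finset.sum_range_succ', mul_add, Finset.mul_sum]
  congr 1
  · refine Finset.sum_congr rfl fun i _ => ?_
    rw [Nat.add_sub_add_right]
    ring
  · simp only [Nat.sub_zero]
    ring

/-- Both sides obey the same recursion in `K`: multiply by 2/(m+n) after adding the next pair of
powers. On the right this is the identity 1/(n-m) - 1/(n+m) = 2m/((n-m)(n+m)) and its companion with
n. -/
theorem weightedGeom_add_of_ne {m n : ℝ} (hm : 0 < m) (hn : 0 < n) (h : m ≠ n) (K : ℕ) :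
    weightedGeom K (1 / (m + n)) (1 / m) + weightedGeom K (1 / (m + n)) (1 / n) =
      2 * ((1 / m) ^ (K + 1) * (1 / (n - m) - 1 / (n + m)) +
        (1 / n) ^ (K + 1) * (1 / (m - n) - 1 / (m + n))) := by
  have h1 : n - m ≠ 0 := sub_ne_zero.2 h.symm
  have h2 : m + n ≠ 0 := by positivity
  have e1 : 1 / (m - n) = -(1 / (n - m)) := by rw [← neg_sub, one_div_neg_eq_neg_one_div]
  rw [e1, add_comm n m]
  induction K with
  | zero =>
    simp only [weightedGeom, Finset.range_zero, Finset.sum_empty, zero_add, pow_one]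
    field_simp
    ring
  | succ K ih =>
    rw [weightedGeom_succ, weightedGeom_succ]
    have key : 2 * (1 / (m + n)) *
        (2 * ((1 / m) ^ (K + 1) * (1 / (n - m) - 1 / (m + n)) +
        (1 / n) ^ (K + 1) * (-(1 / (n - m)) - 1 / (m + n))) +
          2 * (1 / (m + n)) * ((1 / m) ^ (K + 1) + (1 / n) ^ (K + 1))) =
        2 * ((1 / m) ^ (K + 1 + 1) * (1 / (n - m) - 1 / (m + n)) +
        (1 / n) ^ (K + 1 + 1) * (-(1 / (n - m)) - 1 / (m + n))) := by
      -- The terms in (m+n)^(-2) cancel against the added powers; `a1` and `a2` rewrite the rest.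
      have a1 : 2 * (1 / (m + n)) * (1 / (n - m)) = 1 / m * (1 / (n - m) - 1 / (m + n)) := by
        field_simp
        ring
      have a2 : 2 * (1 / (m + n)) * (1 / (n - m)) = 1 / n * (1 / (n - m) + 1 / (m + n)) := by
        field_simp
        ring
      linear_combination 2 * (1 / m) ^ (K + 1) * a1 - 2 * (1 / n) ^ (K + 1) * a2
    rw [← key, ← ih]
    ring

theorem weightedGeom_diag {m : ℝ} (hm : 0 < m) (K : ℕ) :
    weightedGeom K (1 / (m + m)) (1 / m) = K * (1 / m) ^ (K + 2) := by
  induction K with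
  | zero => simp [weightedGeom]
  | succ K ih =>
    rw [weightedGeom_succ, ih]
    have : 2 * (1 / (m + m)) = 1 / m := by field_simp; ring
    rw [this]
    push_cast
    ring

theorem weightedGeom_add_nat {m n : ℕ} (hm : 0 < m) (hn : 0 < n) (K : ℕ) :
    weightedGeom K (1 / ((m : ℝ) + n)) (1 / m) + weightedGeom K (1 / ((m : ℝ) + n)) (1 / n) =
      2 * (shuffleKernel K m n + shuffleKernel K n m) +
        if n = m then 2 * ((K : ℝ) + 1) * (1 / (m : ℝ)) ^ (K + 2) else 0 := by
  have hm' : (0 : ℝ) < m := by exact_mod_cast hm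
  have hn' : (0 : ℝ) < n := by exact_mod_cast hn
  split_ifs with h
  · subst h
    rw [weightedGeom_diag hn']
    have : 1 / ((n : ℝ) + n) = 1 / n / 2 := by field_simp; ring
    -- With 1/0 = 0 the kernels contribute -2 m^(-(K+2)) on the diagonal, while the left side is 2K
    -- m^(-(K+2)); hence the correction 2(K+1).
    simp only [shuffleKernel, sub_self, div_zero, this]
    ring
  · rw [add_zero, weightedGeom_add_of_ne hm' hn' (fun e => h (by exact_mod_cast e.symm))]
    rfl

/-! ### Symmetrization of the truncated double sum -/

theorem sum_Ioo_sum_Ioo_eq_shift {A : Type*} [AddCommMonoid A] (M : ℕ) (φ : ℕ → ℕ → A) :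
    ∑ s ∈ Finset.Ioo 0 M, ∑ m ∈ Finset.Ioo 0 s, φ s m =
      ∑ m ∈ Finset.Ioo 0 M, ∑ n ∈ Finset.Ioo 0 (M - m), φ (m + n) m := by
  rw [Finset.sum_sigma', Finset.sum_sigma']
  refine Finset.sum_nbij' (fun p => ⟨p.2, p.1 - p.2⟩) (fun p => ⟨p.1 + p.2, p.1⟩) ?_ ?_ ?_ ?_ ?_
  · rintro ⟨s, m⟩ h
    simp only [Finset.mem_sigma, Finset.mem_Ioo] at h ⊢
    omega
  · rintro ⟨s, m⟩ h
    simp only [Finset.mem_sigma, Finset.mem_Ioo] at h ⊢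
    omega
  · rintro ⟨s, m⟩ h
    simp only [Finset.mem_sigma, Finset.mem_Ioo] at h ⊢
    rw [Nat.add_sub_cancel' h.2.2.le]
  · rintro ⟨s, m⟩ h
    simp
  · rintro ⟨s, m⟩ h
    simp only [Finset.mem_sigma, Finset.mem_Ioo] at h ⊢
    rw [Nat.add_sub_cancel' h.2.2.le]

theorem sum_Ioo_triangle_swap {A : Type*} [AddCommMonoid A] (M : ℕ) (φ : ℕ → ℕ → A) :
    ∑ m ∈ Finset.Ioo 0 M, ∑ n ∈ Finset.Ioo 0 (M - m), φ m n =
      ∑ m ∈ Finset.Ioo 0 M, ∑ n ∈ Finset.Ioo 0 (M - m), φ n m := by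
  refine Finset.sum_comm' fun x y => ?_
  simp only [Finset.mem_Ioo]
  omega

theorem sum_Ioo_sum_Ioo_comm {A : Type*} [AddCommMonoid A] (M : ℕ) (φ : ℕ → ℕ → A) :
    ∑ u ∈ Finset.Ioo 0 M, ∑ m ∈ Finset.Ioo 0 u, φ u m =
      ∑ m ∈ Finset.Ioo 0 M, ∑ u ∈ Finset.Ioo m M, φ u m := by
  refine Finset.sum_comm' fun x y => ?_
  simp only [Finset.mem_Ioo]
  omega

theorem residueIndicator_two_mul_add (c : ZMod 3) (m n : ℕ) :
    residueIndicator (2 * c) (m + n) * residueIndicator c m =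
      residueIndicator c m * residueIndicator c n := by
  unfold residueIndicator
  by_cases hm : (m : ZMod 3) = c
  · have : ((m + n : ℕ) : ZMod 3) = 2 * c ↔ (n : ZMod 3) = c := by
      push_cast
      rw [hm, two_mul, add_right_inj]
    simp only [this, hm]
    simp
  · simp [hm]

/-- The inner sum over `n` of the shuffle kernel without the factor depending on `m` only. -/
noncomputable def shuffleInner (c : ZMod 3) (M m : ℕ) : ℝ :=
  ∑ n ∈ Finset.Ioo 0 (M - m),
    residueIndicator c n * (1 / ((n : ℝ) - m) - 1 / ((n : ℝ) + m))

theorem levelZetaPartial_pair (j l : ℕ) (a b : ZMod 3) (M : ℕ) :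
    levelZetaPartial 3 [(j, a), (l, b)] M =
      9 * ∑ s ∈ Finset.Ioo 0 M, ∑ m ∈ Finset.Ioo 0 s,
        residueIndicator a s * residueIndicator b m * ((1 / (s : ℝ)) ^ j * (1 / (m : ℝ)) ^ l) := by
  simp only [levelZetaPartial, Finset.sum_filter, Finset.mul_sum, residueIndicator]
  refine Finset.sum_congr rfl fun s _ => ?_
  split_ifs with hs
  · refine Finset.sum_congr rfl fun m _ => ?_
    split_ifs
    · push_cast
      simp only [div_eq_mul_inv]
      ring
    · simp
  · simp

theorem sum_two_pow_mul_levelZetaPartial (K : ℕ) (c : ZMod 3) (M : ℕ) :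
    ∑ j ∈ Finset.Icc 2 (K + 1), (2 : ℝ) ^ j * levelZetaPartial 3 [(j, 2 * c), (K + 2 - j, c)] M =
      9 * ∑ m ∈ Finset.Ioo 0 M, ∑ n ∈ Finset.Ioo 0 (M - m),
        residueIndicator c m * residueIndicator c n * weightedGeom K (1 / ((m : ℝ) + n)) (1 / m) := by
  have h : ∑ j ∈ Finset.Icc 2 (K + 1),
      (2 : ℝ) ^ j * levelZetaPartial 3 [(j, 2 * c), (K + 2 - j, c)] M =
      9 * ∑ s ∈ Finset.Ioo 0 M, ∑ m ∈ Finset.Ioo 0 s,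
        residueIndicator (2 * c) s * residueIndicator c m *
          weightedGeom K (1 / (s : ℝ)) (1 / m) := by
    have e : Finset.Icc 2 (K + 1) = Finset.Ico 2 (K + 2) := by
      ext; simp only [Finset.mem_Icc, Finset.mem_Ico]; omega
    rw [e, Finset.sum_Ico_eq_sum_range]
    simp only [levelZetaPartial_pair, weightedGeom, Finset.mul_sum]
    rw [Finset.sum_comm]
    refine Finset.sum_congr rfl fun s _ => ?_
    rw [Finset.sum_comm]
    refine Finset.sum_congr rfl fun m _ => ?_
    refine Finset.sum_congr (by congr 1) fun i _ => ?_
    rw [show K + 2 - (2 + i) = K - i by omega, mul_pow, add_comm 2 i]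
    ring
  rw [h, sum_Ioo_sum_Ioo_eq_shift]
  simp only [residueIndicator_two_mul_add, Nat.cast_add]

/-- The truncation m + n < M is symmetric, so the sum is half of its symmetrization, and the two
mirror kernels have equal sums. The diagonal n = m lies inside the triangle exactly when 2m < M. -/
theorem sum_two_pow_mul_levelZetaPartial_eq (K : ℕ) (c : ZMod 3) (M : ℕ) :
    ∑ j ∈ Finset.Icc 2 (K + 1), (2 : ℝ) ^ j * levelZetaPartial 3 [(j, 2 * c), (K + 2 - j, c)] M =
      ∑ m ∈ Finset.Ioo 0 M, residueIndicator c m *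
        (18 * (1 / (m : ℝ)) ^ (K + 1) * shuffleInner c M m +
          if 2 * m < M then 9 * ((K : ℝ) + 1) * (1 / (m : ℝ)) ^ (K + 2) else 0) := by
  rw [sum_two_pow_mul_levelZetaPartial]
  set χ := residueIndicator c with hχ
  have swapX := sum_Ioo_triangle_swap M fun m n =>
    χ m * χ n * weightedGeom K (1 / ((m : ℝ) + n)) (1 / m)
  have swapf := sum_Ioo_triangle_swap M fun m n => χ m * χ n * shuffleKernel K m n
  have hsum : ∑ m ∈ Finset.Ioo 0 M, ∑ n ∈ Finset.Ioo 0 (M - m),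
        χ m * χ n * weightedGeom K (1 / ((m : ℝ) + n)) (1 / m) +
      ∑ m ∈ Finset.Ioo 0 M, ∑ n ∈ Finset.Ioo 0 (M - m),
        χ n * χ m * weightedGeom K (1 / ((n : ℝ) + m)) (1 / n) =
      2 * (∑ m ∈ Finset.Ioo 0 M, ∑ n ∈ Finset.Ioo 0 (M - m), χ m * χ n * shuffleKernel K m n +
        ∑ m ∈ Finset.Ioo 0 M, ∑ n ∈ Finset.Ioo 0 (M - m), χ n * χ m * shuffleKernel K n m) +
      ∑ m ∈ Finset.Ioo 0 M, ∑ n ∈ Finset.Ioo 0 (M - m),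
        if n = m then χ m * χ n * (2 * ((K : ℝ) + 1) * (1 / (m : ℝ)) ^ (K + 2)) else 0 := by
    simp only [Finset.mul_sum, ← Finset.sum_add_distrib]
    refine Finset.sum_congr rfl fun m hm => Finset.sum_congr rfl fun n hn => ?_
    have := weightedGeom_add_nat (Finset.mem_Ioo.1 hm).1 (Finset.mem_Ioo.1 hn).1 K
    rw [add_comm (n : ℝ) m]
    split_ifs at this ⊢ <;> linear_combination χ m * χ n * this
  have hdiag : ∑ m ∈ Finset.Ioo 0 M, ∑ n ∈ Finset.Ioo 0 (M - m),
        (if n = m then χ m * χ n * (2 * ((K : ℝ) + 1) * (1 / (m : ℝ)) ^ (K + 2)) else 0) =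
      ∑ m ∈ Finset.Ioo 0 M, χ m *
        if 2 * m < M then 2 * ((K : ℝ) + 1) * (1 / (m : ℝ)) ^ (K + 2) else 0 := by
    refine Finset.sum_congr rfl fun m hm => ?_
    rw [Finset.sum_ite_eq']
    have hm' := Finset.mem_Ioo.1 hm
    have hsq : χ m * χ m = χ m := by
      simp only [hχ, residueIndicator]; split_ifs <;> simp
    by_cases h : 2 * m < M
    · rw [if_pos (Finset.mem_Ioo.2 (by omega)), if_pos h, hsq]
    · rw [if_neg (by rw [Finset.mem_Ioo]; omega), if_neg h, mul_zero]
  have hf : ∑ m ∈ Finset.Ioo 0 M, ∑ n ∈ Finset.Ioo 0 (M - m), χ m * χ n * shuffleKernel K m n =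
      ∑ m ∈ Finset.Ioo 0 M, χ m * ((1 / (m : ℝ)) ^ (K + 1) * shuffleInner c M m) := by
    refine Finset.sum_congr rfl fun m _ => ?_
    simp only [shuffleInner, Finset.mul_sum, shuffleKernel]
    refine Finset.sum_congr rfl fun n _ => ?_
    ring
  have hR : ∑ m ∈ Finset.Ioo 0 M, χ m *
        (18 * (1 / (m : ℝ)) ^ (K + 1) * shuffleInner c M m +
          if 2 * m < M then 9 * ((K : ℝ) + 1) * (1 / (m : ℝ)) ^ (K + 2) else 0) =
      18 * ∑ m ∈ Finset.Ioo 0 M, χ m * ((1 / (m : ℝ)) ^ (K + 1) * shuffleInner c M m) +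
      9 / 2 * ∑ m ∈ Finset.Ioo 0 M, χ m *
        if 2 * m < M then 2 * ((K : ℝ) + 1) * (1 / (m : ℝ)) ^ (K + 2) else 0 := by
    simp only [Finset.mul_sum, ← Finset.sum_add_distrib]
    refine Finset.sum_congr rfl fun m _ => ?_
    split_ifs <;> ring
  rw [hR, ← hf, ← hdiag]
  linear_combination 9 / 2 * hsum + 9 / 2 * swapX - 9 * swapf

/-! ### Dirichlet's test and bounds uniform in the cutoff -/

/-- Dirichlet's test: complete periods sum to zero, so the partial sums of g are bounded, and 1/u
decreases to 0. -/
theorem tendsto_sum_div_of_periodic_three {E : Type*} [NormedAddCommGroup E] [NormedSpace ℝ E]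
    [CompleteSpace E] (g : ℕ → E) (hper : ∀ u, g (u + 3) = g u) (hzero : g 0 + g 1 + g 2 = 0) :
    ∃ l : E, Tendsto (fun M : ℕ => ∑ u ∈ Finset.Ioo 0 M, (1 / (u : ℝ)) • g u) atTop (𝓝 l) := by
  have hwin : ∀ u, g u + g (u + 1) + g (u + 2) = 0 := by
    intro u
    induction u with
    | zero => simpa using hzero
    | succ u ih =>
      rw [show u + 1 + 2 = u + 3 by ring, hper, ← ih]
      abel
  have hbd : ∀ n, ‖∑ i ∈ Finset.range n, g (i + 1)‖ ≤ ‖g 1‖ + ‖g 2‖ := by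
    have h3 : ∀ q, ∑ i ∈ Finset.range (3 * q), g (i + 1) = 0 := by
      intro q
      induction q with
      | zero => simp
      | succ q ih =>
        rw [show 3 * (q + 1) = 3 * q + 1 + 1 + 1 by ring, Finset.sum_range_succ,
          Finset.sum_range_succ, Finset.sum_range_succ, ih, zero_add]
        exact hwin (3 * q + 1)
    have hp : ∀ q r, g (3 * q + r) = g r := by
      intro q r
      induction q with
      | zero => simp
      | succ q ih => rw [← ih, ← hper (3 * q + r)]; congr 1; ring
    intro n
    obtain ⟨q, r, hr, rfl⟩ : ∃ q r, r < 3 ∧ n = 3 * q + r :=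
      ⟨n / 3, n % 3, Nat.mod_lt _ (by norm_num), (Nat.div_add_mod n 3).symm⟩
    interval_cases r
    · rw [add_zero, h3, norm_zero]; positivity
    · rw [Finset.sum_range_succ, h3, zero_add, hp]
      exact le_add_of_nonneg_right (norm_nonneg _)
    · rw [show 3 * q + 2 = 3 * q + 1 + 1 by ring, Finset.sum_range_succ, Finset.sum_range_succ, h3,
        zero_add, hp, add_assoc, hp]
      exact norm_add_le _ _
  have hanti : Antitone fun i : ℕ => 1 / ((i : ℝ) + 1) := by
    intro a b hab
    have : (a : ℝ) ≤ b := by exact_mod_cast hab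
    dsimp only
    gcongr
  obtain ⟨l, hl⟩ := cauchySeq_tendsto_of_complete
    (hanti.cauchySeq_series_mul_of_tendsto_zero_of_bounded tendsto_one_div_add_atTop_nhds_zero_nat
      hbd)
  refine ⟨l, (tendsto_add_atTop_iff_nat 1).1 (hl.congr fun n => ?_)⟩
  refine Finset.sum_nbij' (fun i => i + 1) (fun i => i - 1) ?_ ?_ ?_ ?_ ?_ <;>
    simp <;> omega

theorem sum_Ioo_eq_sub {E : Type*} [AddCommGroup E] (f : ℕ → E) {m M : ℕ} (h : m < M) :
    ∑ u ∈ Finset.Ioo m M, f u =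
      ∑ u ∈ Finset.Ioo 0 M, f u - ∑ u ∈ Finset.Ioo 0 (m + 1), f u := by
  rw [eq_sub_iff_add_eq, ← Finset.sum_union]
  · congr 1
    ext x; simp only [Finset.mem_union, Finset.mem_Ioo]; omega
  · rw [Finset.disjoint_left]
    intro x; simp only [Finset.mem_Ioo]; omega

theorem exists_norm_sum_Ioo_le {E : Type*} [NormedAddCommGroup E] {f : ℕ → E} {l : E}
    (h : Tendsto (fun M : ℕ => ∑ u ∈ Finset.Ioo 0 M, f u) atTop (𝓝 l)) :
    ∃ C, 0 ≤ C ∧ (∀ M, ‖∑ u ∈ Finset.Ioo 0 M, f u‖ ≤ C) ∧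
      ∀ m M, ‖∑ u ∈ Finset.Ioo m M, f u‖ ≤ C := by
  obtain ⟨B, hB⟩ := (Metric.isBounded_range_of_tendsto _ h).exists_norm_le
  have hB' : ∀ M, ‖∑ u ∈ Finset.Ioo 0 M, f u‖ ≤ B := fun M => hB _ ⟨M, rfl⟩
  have hB0 : 0 ≤ B := (norm_nonneg _).trans (hB' 0)
  refine ⟨B + B, by positivity, fun M => (hB' M).trans (by linarith), fun m M => ?_⟩
  rcases lt_or_ge m M with hmM | hmM
  · rw [sum_Ioo_eq_sub f hmM]
    exact (norm_sub_le _ _).trans (add_le_add (hB' _) (hB' _))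
  · rw [Finset.Ioo_eq_empty (by omega), Finset.sum_empty, norm_zero]; positivity

theorem summable_int_one_div_mul_sqrt :
    Summable fun d : ℤ => 1 / (|(d : ℝ)| * √|(d : ℝ)|) := by
  refine (Real.summable_abs_int_rpow (b := 3 / 2) (by norm_num)).congr fun d => ?_
  rw [Real.rpow_neg (abs_nonneg _), one_div, Real.sqrt_eq_rpow,
    show (3 / 2 : ℝ) = 1 + 1 / 2 by norm_num,
    Real.rpow_add' (abs_nonneg _) (by norm_num), Real.rpow_one]

theorem summable_nat_one_div_mul_sqrt : Summable fun m : ℕ => 1 / ((m : ℝ) * √m) := by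
  have := summable_int_one_div_mul_sqrt.comp_injective (i := ((↑) : ℕ → ℤ)) Nat.cast_injective
  simpa [Function.comp_def] using this

theorem one_div_sq_mul_sqrt {x : ℝ} (hx : 0 < x) : (1 / x) ^ 2 * √x = 1 / (x * √x) := by
  have hs : √x ≠ 0 := (Real.sqrt_pos.2 hx).ne'
  rw [div_pow, one_pow, div_mul_eq_mul_div, one_mul, div_eq_div_iff (by positivity)
    (by positivity), one_mul]
  calc √x * (x * √x) = x * (√x * √x) := by ring
    _ = x ^ 2 := by rw [Real.mul_self_sqrt hx.le]; ring

theorem abs_residueIndicator_mul_le (c : ZMod 3) (n : ℕ) (x : ℝ) :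
    |residueIndicator c n * x| ≤ |x| := by
  unfold residueIndicator
  split_ifs <;> simp

/-- The difference is 2m/((n-m)(n+m)), and √m √|n-m| ≤ n + m. Half a power of m is spent to make the
bound summable over all integers n - m. -/
theorem abs_one_div_sub_one_div_le {m n : ℕ} (hm : 0 < m) (h : n ≠ m) :
    |1 / ((n : ℝ) - m) - 1 / ((n : ℝ) + m)| ≤
      2 * √m * (1 / (|((n - m : ℤ) : ℝ)| * √|((n - m : ℤ) : ℝ)|)) := by
  push_cast
  set d := |(n : ℝ) - m| with hd
  have hm' : (0 : ℝ) < m := by exact_mod_cast hm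
  have hne : (n : ℝ) - m ≠ 0 := sub_ne_zero.2 (by exact_mod_cast h)
  have hd0 : 0 < d := abs_pos.2 hne
  have hs : (0 : ℝ) < n + m := by positivity
  have hds : d ≤ n + m := by
    rw [hd, abs_le]; constructor <;> linarith [(Nat.cast_nonneg n : (0 : ℝ) ≤ n)]
  have e : 1 / ((n : ℝ) - m) - 1 / ((n : ℝ) + m) = 2 * m / (((n : ℝ) - m) * (n + m)) := by
    field_simp; ring
  rw [e, abs_div, abs_mul, abs_mul, ← hd, abs_of_pos hs, abs_of_pos hm', abs_two, mul_one_div,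
    div_le_div_iff₀ (by positivity) (by positivity)]
  have h1 : √(m : ℝ) * √d ≤ n + m := by
    nlinarith [sq_nonneg (√(m : ℝ) - √d), Real.sq_sqrt hm'.le, Real.sq_sqrt hd0.le,
      (Nat.cast_nonneg n : (0 : ℝ) ≤ n)]
  calc 2 * (m : ℝ) * (d * √d) = 2 * √m * d * (√m * √d) := by
        nth_rewrite 1 [← Real.mul_self_sqrt hm'.le]; ring
    _ ≤ 2 * √m * d * (n + m) := by gcongr
    _ = 2 * √m * (d * (n + m)) := by ring

theorem exists_abs_shuffleInner_le (c : ZMod 3) :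
    ∃ C, 0 ≤ C ∧ ∀ M m, 0 < m → |shuffleInner c M m| ≤ C * √m := by
  set g : ℤ → ℝ := fun d => 1 / (|(d : ℝ)| * √|(d : ℝ)|) with hg
  have hg0 : ∀ d, 0 ≤ g d := fun d => by positivity
  -- The extra 1 pays for the term n = m, where only -1/(2m) survives.
  refine ⟨2 * ∑' d, g d + 1, by have : 0 ≤ ∑' d, g d := tsum_nonneg hg0; positivity, fun M m hm => ?_⟩
  have hm1 : (1 : ℝ) ≤ m := by exact_mod_cast hm
  have hinj : Function.Injective fun n : ℕ => (n : ℤ) - m := fun a b h => by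
    simpa using h
  have hterm : ∀ n : ℕ, |residueIndicator c n * (1 / ((n : ℝ) - m) - 1 / ((n : ℝ) + m))| ≤
      2 * √m * g (n - m) + if n = m then 1 else 0 := by
    intro n
    refine (abs_residueIndicator_mul_le _ _ _).trans ?_
    split_ifs with h
    · subst h
      have h2 : |1 / ((n : ℝ) + n)| ≤ 1 := by
        rw [abs_of_nonneg (by positivity), div_le_one (by positivity)]; linarith
      simpa [hg] using h2
    · simpa [hg] using abs_one_div_sub_one_div_le hm h
  have hsum : ∑ n ∈ Finset.Ioo 0 (M - m), g (n - m) ≤ ∑' d, g d :=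
    ((summable_int_one_div_mul_sqrt.comp_injective hinj).sum_le_tsum _ fun n _ => hg0 _).trans
      (tsum_comp_le_tsum_of_inj summable_int_one_div_mul_sqrt hg0 hinj)
  have hone : ∑ n ∈ Finset.Ioo 0 (M - m), (if n = m then (1 : ℝ) else 0) ≤ 1 := by
    rw [Finset.sum_ite_eq']; split_ifs <;> norm_num
  calc |shuffleInner c M m| ≤ ∑ n ∈ Finset.Ioo 0 (M - m),
        (2 * √m * g (n - m) + if n = m then 1 else 0) :=
        (Finset.abs_sum_le_sum_abs _ _).trans (Finset.sum_le_sum fun n _ => hterm n)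
    _ ≤ 2 * √m * (∑' d, g d) + 1 := by
        rw [Finset.sum_add_distrib, ← Finset.mul_sum]; gcongr
    _ ≤ (2 * ∑' d, g d + 1) * √m := by
        have : 1 ≤ √(m : ℝ) := Real.one_le_sqrt.2 hm1
        linarith

/-! ### Reflection and evaluation of the inner sum -/

theorem residueIndicator_eq_of_iff {a b : ZMod 3} {m n : ℕ}
    (h : (m : ZMod 3) = a ↔ (n : ZMod 3) = b) : residueIndicator a m = residueIndicator b n := by
  simp only [residueIndicator, h]

/-- The map n ↦ 2m - n preserves the class of m and changes the sign of n - m; the central term is 0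
because 1/0 = 0. -/
theorem sum_residueIndicator_div_reflect (m : ℕ) :
    ∑ n ∈ Finset.Ioo 0 (2 * m), residueIndicator m n * (1 / ((n : ℝ) - m)) = 0 := by
  have h : ∑ n ∈ Finset.Ioo 0 (2 * m), residueIndicator m n * (1 / ((n : ℝ) - m)) =
      ∑ n ∈ Finset.Ioo 0 (2 * m), -(residueIndicator m n * (1 / ((n : ℝ) - m))) := by
    refine Finset.sum_nbij' (fun n => 2 * m - n) (fun n => 2 * m - n) ?_ ?_ ?_ ?_ ?_
    · intro n; simp only [Finset.mem_Ioo]; omega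
    · intro n; simp only [Finset.mem_Ioo]; omega
    · intro n; simp only [Finset.mem_Ioo]; omega
    · intro n; simp only [Finset.mem_Ioo]; omega
    · intro n hn
      have hn' := (Finset.mem_Ioo.1 hn).2.le
      have e : residueIndicator m (2 * m - n) = residueIndicator m n := by
        refine residueIndicator_eq_of_iff ?_
        rw [Nat.cast_sub hn']
        push_cast
        constructor <;> intro h <;> linear_combination -h
      rw [e, Nat.cast_sub hn', ← mul_neg, ← one_div_neg_eq_neg_one_div]
      push_cast
      ring_nf
  rw [Finset.sum_neg_distrib] at h
  linarith

/-- After the reflection, n - m is divisible by 3 and runs up to M - 2m, while n + m ≡ 2c runs up to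
M. Extending the first range to M produces the subtracted block; `hM` ensures that the reflection
interval fits below M - m. -/
theorem shuffleInner_eq {c : ZMod 3} (hc : c ≠ 0) {M m : ℕ} (hm : (m : ZMod 3) = c)
    (hM : 3 * m < M) :
    shuffleInner c M m = ∑ u ∈ Finset.Ioo m M, residueDiff c u * (1 / (u : ℝ)) -
      ∑ u ∈ Finset.Ico (M - 2 * m) M, residueIndicator 0 u * (1 / (u : ℝ)) := by
  subst hm
  have hm0 : 0 < m := Nat.pos_of_ne_zero fun h => hc (by simp [h])
  have h1 : ∑ n ∈ Finset.Ioo 0 (M - m), residueIndicator m n * (1 / ((n : ℝ) + m)) =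
      ∑ u ∈ Finset.Ioo m M, residueIndicator (2 * m) u * (1 / (u : ℝ)) := by
    refine Finset.sum_nbij' (fun n => n + m) (fun n => n - m) ?_ ?_ ?_ ?_ ?_
    · intro n; simp only [Finset.mem_Ioo]; omega
    · intro n; simp only [Finset.mem_Ioo]; omega
    · intro n; simp
    · intro n; simp only [Finset.mem_Ioo]; omega
    · intro n _
      rw [Nat.cast_add]
      congr 1
      refine residueIndicator_eq_of_iff ?_
      push_cast
      constructor <;> intro h <;> linear_combination h
  have h2 : ∑ n ∈ Finset.Ioo 0 (M - m), residueIndicator m n * (1 / ((n : ℝ) - m)) =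
      ∑ u ∈ Finset.Ico m (M - 2 * m), residueIndicator 0 u * (1 / (u : ℝ)) := by
    have hsplit : Finset.Ioo 0 (M - m) = Finset.Ioo 0 (2 * m) ∪ Finset.Ico (2 * m) (M - m) := by
      ext x; simp only [Finset.mem_union, Finset.mem_Ioo, Finset.mem_Ico]; omega
    rw [hsplit, Finset.sum_union, sum_residueIndicator_div_reflect, zero_add]
    · refine Finset.sum_nbij' (fun n => n - m) (fun n => n + m) ?_ ?_ ?_ ?_ ?_
      · intro n; simp only [Finset.mem_Ico]; omega
      · intro n; simp only [Finset.mem_Ico]; omega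
      · intro n; simp only [Finset.mem_Ico]; omega
      · intro n; simp
      · intro n hn
        have hn' : m ≤ n := by rw [Finset.mem_Ico] at hn; omega
        rw [Nat.cast_sub hn']
        congr 1
        refine residueIndicator_eq_of_iff ?_
        rw [Nat.cast_sub hn', sub_eq_zero]
    · rw [Finset.disjoint_left]
      intro x; simp only [Finset.mem_Ioo, Finset.mem_Ico]; omega
  have h3 : ∑ u ∈ Finset.Ico m (M - 2 * m), residueIndicator 0 u * (1 / (u : ℝ)) =
      ∑ u ∈ Finset.Ioo m M, residueIndicator 0 u * (1 / (u : ℝ)) -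
      ∑ u ∈ Finset.Ico (M - 2 * m) M, residueIndicator 0 u * (1 / (u : ℝ)) := by
    -- The endpoint u = m may be dropped since m ≢ 0 (mod 3).
    rw [eq_sub_iff_add_eq, Finset.sum_Ico_consecutive _ (by omega) (by omega),
      ← Finset.sum_Ioo_add_eq_sum_Ico (by omega : m < M)]
    simp [residueIndicator, hc]
  simp only [shuffleInner, residueDiff, mul_sub, sub_mul, Finset.sum_sub_distrib]
  rw [h1, h2, h3]
  ring

/-- For fixed m there are only 2m terms, each at most 1/(M - 2m). -/
theorem tendsto_sum_Ico_residueIndicator_div (m : ℕ) :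
    Tendsto (fun M : ℕ => ∑ u ∈ Finset.Ico (M - 2 * m) M, residueIndicator 0 u * (1 / (u : ℝ)))
      atTop (𝓝 0) := by
  have hlim : Tendsto (fun M : ℕ => 2 * (m : ℝ) * (1 / ((M - 2 * m : ℕ) : ℝ))) atTop (𝓝 0) := by
    have := ((tendsto_one_div_atTop_nhds_zero_nat (𝕜 := ℝ)).comp
      (tendsto_sub_atTop_nat (2 * m))).const_mul (2 * (m : ℝ))
    simpa [Function.comp_def] using this
  refine squeeze_zero_norm' ?_ hlim
  filter_upwards [eventually_gt_atTop (2 * m)] with M hM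
  have hpos : (0 : ℝ) < ((M - 2 * m : ℕ) : ℝ) := by exact_mod_cast Nat.sub_pos_of_lt hM
  refine (norm_sum_le_of_le _ (f := fun u => residueIndicator 0 u * (1 / (u : ℝ)))
    (n := fun _ => 1 / ((M - 2 * m : ℕ) : ℝ)) fun u hu => ?_).trans ?_
  · refine (abs_residueIndicator_mul_le _ _ _).trans ?_
    rw [abs_of_nonneg (by positivity)]
    exact one_div_le_one_div_of_le hpos (by exact_mod_cast (Finset.mem_Ico.1 hu).1)
  · rw [Finset.sum_const, Nat.card_Ico, nsmul_eq_mul, show M - (M - 2 * m) = 2 * m by omega]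
    push_cast
    rfl

theorem exists_abs_sum_residueDiff_le {c : ZMod 3} (hc : c ≠ 0) :
    ∃ C, 0 ≤ C ∧ ∀ m M, |∑ u ∈ Finset.Ioo m M, residueDiff c u * (1 / (u : ℝ))| ≤ C := by
  have h30 : (3 : ZMod 3) = 0 := rfl
  obtain ⟨l, hl⟩ := tendsto_sum_div_of_periodic_three (residueDiff c)
    (fun u => by simp [residueDiff, residueIndicator, h30])
    (by
      revert c
      intro c hc
      have : c = 1 ∨ c = 2 := by revert c; decide
      have e1 : (1 : ZMod 3) ≠ 2 := by decide
      have e2 : (2 : ZMod 3) ≠ 0 := by decide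
      have e3 : (2 : ZMod 3) * 2 = 1 := by decide
      rcases this with rfl | rfl
      · simp [residueDiff, residueIndicator, e1, e2, e2.symm]
      · simp [residueDiff, residueIndicator, e1.symm, e2, e3])
  obtain ⟨C, hC0, -, hC⟩ := exists_norm_sum_Ioo_le hl
  refine ⟨C, hC0, fun m M => ?_⟩
  simpa only [smul_eq_mul, mul_comm, Real.norm_eq_abs] using hC m M

/-! ### Vanishing of the truncation error -/

/-- The finite real combination matching the partial sums of the right-hand side. -/
noncomputable def twistedPartial (K : ℕ) (c : ZMod 3) (M : ℕ) : ℝ :=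
  ∑ m ∈ Finset.Ioo 0 M, residueIndicator c m *
    (18 * (1 / (m : ℝ)) ^ (K + 1) * ∑ u ∈ Finset.Ioo m M, residueDiff c u * (1 / (u : ℝ)) +
      9 * ((K : ℝ) + 1) * (1 / (m : ℝ)) ^ (K + 2))

theorem tendsto_levelZetaPartial_sub_twistedPartial {K : ℕ} (hK : 1 ≤ K) {c : ZMod 3}
    (hc : c ≠ 0) :
    Tendsto (fun M => ∑ j ∈ Finset.Icc 2 (K + 1),
      (2 : ℝ) ^ j * levelZetaPartial 3 [(j, 2 * c), (K + 2 - j, c)] M - twistedPartial K c M)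
      atTop (𝓝 0) := by
  obtain ⟨C₁, hC₁, h₁⟩ := exists_abs_shuffleInner_le c
  obtain ⟨C₂, hC₂, h₂⟩ := exists_abs_sum_residueDiff_le hc
  set D : ℕ → ℕ → ℝ := fun M m => ∑ u ∈ Finset.Ioo m M, residueDiff c u * (1 / (u : ℝ)) with hD
  -- Extending the summand by 0 beyond M makes the error a series over all m. For fixed m, once M >
  -- 3m, only the block near M remains, and it tends to 0.
  set F : ℕ → ℕ → ℝ := fun M m => if m ∈ Finset.Ioo 0 M then residueIndicator c m *
    (18 * (1 / (m : ℝ)) ^ (K + 1) * (shuffleInner c M m - D M m) +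
      if 2 * m < M then 0 else -(9 * ((K : ℝ) + 1) * (1 / (m : ℝ)) ^ (K + 2))) else 0 with hF
  have hsum : ∀ M, ∑ j ∈ Finset.Icc 2 (K + 1),
      (2 : ℝ) ^ j * levelZetaPartial 3 [(j, 2 * c), (K + 2 - j, c)] M - twistedPartial K c M =
      ∑' m, F M m := by
    intro M
    rw [tsum_eq_sum (s := Finset.Ioo 0 M) fun m hm => if_neg hm,
      sum_two_pow_mul_levelZetaPartial_eq, twistedPartial, ← Finset.sum_sub_distrib]
    refine Finset.sum_congr rfl fun m hm => ?_
    simp only [if_pos hm, hD]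
    split_ifs <;> ring
  simp only [hsum]
  rw [← tsum_zero (α := ℝ) (β := ℕ)]
  refine tendsto_tsum_of_dominated_convergence
    (bound := fun m : ℕ => (18 * (C₁ + C₂) + 9 * ((K : ℝ) + 1)) * (1 / ((m : ℝ) * √m)))
    (summable_nat_one_div_mul_sqrt.mul_left _) (fun m => ?_) (Eventually.of_forall fun M m => ?_)
  · by_cases hm : (m : ZMod 3) = c
    · have := ((tendsto_sum_Ico_residueIndicator_div m).const_mul
        (-(18 * (1 / (m : ℝ)) ^ (K + 1))))
      rw [mul_zero] at this
      refine this.congr' ?_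
      filter_upwards [eventually_gt_atTop (3 * m)] with M hM
      have hm0 : 0 < m := Nat.pos_of_ne_zero fun h => hc (by rw [← hm]; simp [h])
      simp only [hF, hD]
      rw [if_pos (Finset.mem_Ioo.2 (by omega)), if_pos (by omega), shuffleInner_eq hc hm hM,
        residueIndicator, if_pos hm]
      ring
    · refine tendsto_const_nhds.congr fun M => ?_
      simp [hF, residueIndicator, hm]
  · simp only [hF]
    split_ifs with hm
    all_goals try (rw [norm_zero]; positivity)
    all_goals
      have hm0 := (Finset.mem_Ioo.1 hm).1
      have hm1 : (1 : ℝ) ≤ m := by exact_mod_cast hm0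
      have hs1 : 1 ≤ √(m : ℝ) := Real.one_le_sqrt.2 hm1
      have hx0 : 0 ≤ 1 / (m : ℝ) := by positivity
      have hx1 : 1 / (m : ℝ) ≤ 1 := (div_le_one (by linarith)).2 hm1
      have hp1 : (1 / (m : ℝ)) ^ (K + 1) ≤ (1 / (m : ℝ)) ^ 2 :=
        pow_le_pow_of_le_one hx0 hx1 (by omega)
      have hp2 : (1 / (m : ℝ)) ^ (K + 2) ≤ (1 / (m : ℝ)) ^ 2 :=
        pow_le_pow_of_le_one hx0 hx1 (by omega)
      have hmsq := one_div_sq_mul_sqrt (show (0 : ℝ) < m by linarith)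
      have hdiff : |shuffleInner c M m - D M m| ≤ (C₁ + C₂) * √m := by
        calc |shuffleInner c M m - D M m| ≤ |shuffleInner c M m| + |D M m| := abs_sub _ _
          _ ≤ C₁ * √m + C₂ := add_le_add (h₁ M m hm0) (h₂ m M)
          _ ≤ (C₁ + C₂) * √m := by nlinarith
      have hmain : |18 * (1 / (m : ℝ)) ^ (K + 1) * (shuffleInner c M m - D M m)| ≤
          18 * (C₁ + C₂) * ((1 / (m : ℝ)) ^ 2 * √m) := by
        rw [abs_mul, abs_of_nonneg (by positivity : (0 : ℝ) ≤ 18 * (1 / (m : ℝ)) ^ (K + 1))]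
        calc 18 * (1 / (m : ℝ)) ^ (K + 1) * |shuffleInner c M m - D M m| ≤
            18 * (1 / (m : ℝ)) ^ 2 * ((C₁ + C₂) * √m) := by gcongr
          _ = _ := by ring
      have hrest : 9 * ((K : ℝ) + 1) * (1 / (m : ℝ)) ^ (K + 2) ≤
          9 * ((K : ℝ) + 1) * ((1 / (m : ℝ)) ^ 2 * √m) := by
        gcongr
        exact hp2.trans (le_mul_of_one_le_right (by positivity) hs1)
      rw [← hmsq]
      refine (abs_residueIndicator_mul_le _ _ _).trans ((abs_add_le _ _).trans ?_)
      rw [add_mul]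
      refine add_le_add hmain ?_
    · rw [abs_zero]; positivity
    · rw [abs_neg, abs_of_nonneg (by positivity)]; exact hrest

/-! ### Convergence of the series -/

theorem tendsto_sum_Ioo_of_summable {E : Type*} [AddCommMonoid E] [TopologicalSpace E] {f : ℕ → E}
    (h0 : f 0 = 0) (hf : Summable f) :
    Tendsto (fun M => ∑ m ∈ Finset.Ioo 0 M, f m) atTop (𝓝 (∑' m, f m)) := by
  refine hf.hasSum.tendsto_sum_nat.congr fun M => ?_
  refine (Finset.sum_subset (fun x => by simp) fun x _ hx' => ?_).symm
  have : x = 0 := by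
    simp only [Finset.mem_Ioo, Finset.mem_range] at *; omega
  rw [this, h0]

theorem exists_tendsto_sum_Ioo_of_norm_le {E : Type*} [NormedAddCommGroup E] [CompleteSpace E]
    {f : ℕ → E} {C : ℝ} (h : ∀ m, 0 < m → ‖f m‖ ≤ C * (1 / ((m : ℝ) * √m))) :
    ∃ l, Tendsto (fun M => ∑ m ∈ Finset.Ioo 0 M, f m) atTop (𝓝 l) := by
  set f' : ℕ → E := fun m => if m = 0 then 0 else f m with hf'
  have hs : Summable f' := by
    refine (summable_nat_one_div_mul_sqrt.mul_left C).of_norm_bounded fun m => ?_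
    rcases Nat.eq_zero_or_pos m with rfl | hm
    · simp [hf']
    · simpa only [hf', if_neg hm.ne'] using h m hm
  refine ⟨_, (tendsto_sum_Ioo_of_summable (by simp [hf']) hs).congr fun M =>
    Finset.sum_congr rfl fun m hm => ?_⟩
  exact if_neg (Finset.mem_Ioo.1 hm).1.ne'

theorem one_div_pow_le_one_div_mul_sqrt {m : ℕ} (hm : 0 < m) {j : ℕ} (hj : 2 ≤ j) :
    (1 / (m : ℝ)) ^ j ≤ 1 / ((m : ℝ) * √m) := by
  have hm1 : (1 : ℝ) ≤ m := by exact_mod_cast hm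
  rw [← one_div_sq_mul_sqrt (show (0 : ℝ) < m by linarith)]
  exact (pow_le_pow_of_le_one (by positivity) ((div_le_one (by linarith)).2 hm1) hj).trans
    (le_mul_of_one_le_right (by positivity) (Real.one_le_sqrt.2 hm1))

/-- Since 1/m ≤ √s/(m√m) for m < s, the inner sum is O(√s), leaving a majorant s^(-3/2). -/
theorem levelZetaConverges_pair {j l : ℕ} (hj : 2 ≤ j) (hl : 1 ≤ l) (a b : ZMod 3) :
    LevelZetaConverges 3 [(j, a), (l, b)] := by
  set Z : ℝ := ∑' m : ℕ, 1 / ((m : ℝ) * √m)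
  have hZ : 0 ≤ Z := tsum_nonneg fun m => by positivity
  have hbd : ∀ s : ℕ, 0 < s → ‖∑ m ∈ Finset.Ioo 0 s, residueIndicator a s * residueIndicator b m *
      ((1 / (s : ℝ)) ^ j * (1 / (m : ℝ)) ^ l)‖ ≤ Z * (1 / ((s : ℝ) * √s)) := by
    intro s hs
    have hs1 : (1 : ℝ) ≤ s := by exact_mod_cast hs
    have hterm : ∀ m ∈ Finset.Ioo 0 s, ‖residueIndicator a s * residueIndicator b m *
        ((1 / (s : ℝ)) ^ j * (1 / (m : ℝ)) ^ l)‖ ≤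
        (1 / (s : ℝ)) ^ 2 * √s * (1 / ((m : ℝ) * √m)) := by
      intro m hm
      obtain ⟨hm0, hms⟩ := Finset.mem_Ioo.1 hm
      have hm1 : (1 : ℝ) ≤ m := by exact_mod_cast hm0
      have hroot : √(m : ℝ) ≤ √s := Real.sqrt_le_sqrt (by exact_mod_cast hms.le)
      have hsm : 0 < √(m : ℝ) := Real.sqrt_pos.2 (by linarith)
      rw [mul_assoc]
      refine (abs_residueIndicator_mul_le _ _ _).trans
        ((abs_residueIndicator_mul_le _ _ _).trans ?_)
      rw [abs_of_nonneg (by positivity), mul_assoc]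
      gcongr ?_ * ?_
      · exact pow_le_pow_of_le_one (by positivity) ((div_le_one (by linarith)).2 hs1) hj
      · calc (1 / (m : ℝ)) ^ l ≤ (1 / (m : ℝ)) ^ 1 :=
            pow_le_pow_of_le_one (by positivity) ((div_le_one (by linarith)).2 hm1) hl
          _ = √m * (1 / ((m : ℝ) * √m)) := by field_simp
          _ ≤ √s * (1 / ((m : ℝ) * √m)) := by gcongr
    refine (norm_sum_le_of_le _ hterm).trans ?_
    rw [← Finset.mul_sum, one_div_sq_mul_sqrt (by linarith), mul_comm]
    gcongr
    exact summable_nat_one_div_mul_sqrt.sum_le_tsum _ fun m _ => by positivity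
  obtain ⟨x, hx⟩ := exists_tendsto_sum_Ioo_of_norm_le hbd
  exact ⟨9 * x, (hx.const_mul 9).congr fun M => (levelZetaPartial_pair j l a b M).symm⟩

/-! ### Cube roots of unity and the L-series -/

theorem isPrimitiveRoot_levelRoot_three : IsPrimitiveRoot (levelRoot 3) 3 := by
  have := Complex.isPrimitiveRoot_exp 3 (by norm_num)
  simpa [levelRoot] using this

theorem levelRoot_three_pow_three : levelRoot 3 ^ 3 = 1 :=
  isPrimitiveRoot_levelRoot_three.pow_eq_one

theorem levelRoot_three_sq : levelRoot 3 ^ 2 + levelRoot 3 + 1 = 0 := by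
  have := isPrimitiveRoot_levelRoot_three.geom_sum_eq_zero (by norm_num)
  simp only [Finset.sum_range_succ, Finset.sum_range_zero] at this
  linear_combination this

theorem norm_levelRoot_three_pow (n : ℕ) : ‖levelRoot 3 ^ n‖ = 1 := by
  rw [norm_pow, isPrimitiveRoot_levelRoot_three.norm'_eq_one (by norm_num), one_pow]

theorem multipleLPartial_singleton (l : ℕ) (a : ZMod 3) (M : ℕ) :
    multipleLPartial 3 [(l, a)] M =
      ∑ m ∈ Finset.Ioo 0 M, (1 / (m : ℂ)) ^ l * (levelRoot 3 ^ m) ^ a.val := by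
  simp only [multipleLPartial]
  refine Finset.sum_congr rfl fun m _ => ?_
  rw [← pow_mul, mul_comm m]
  ring

theorem multipleLPartial_pair (l : ℕ) (a b : ZMod 3) (M : ℕ) :
    multipleLPartial 3 [(1, a), (l, b)] M =
      ∑ m ∈ Finset.Ioo 0 M, ∑ u ∈ Finset.Ioo m M,
        (1 / (m : ℂ)) ^ l * (levelRoot 3 ^ m) ^ b.val *
          ((1 / (u : ℂ)) * (levelRoot 3 ^ u) ^ a.val) := by
  rw [← sum_Ioo_sum_Ioo_comm]
  simp only [multipleLPartial, Finset.mul_sum]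
  refine Finset.sum_congr rfl fun u _ => Finset.sum_congr rfl fun m _ => ?_
  rw [← pow_mul, mul_comm m, ← pow_mul, mul_comm u]
  ring

theorem norm_one_div_pow_mul_levelRoot_le {m : ℕ} (hm : 0 < m) {l : ℕ} (hl : 2 ≤ l) (a : ℕ) :
    ‖(1 / (m : ℂ)) ^ l * (levelRoot 3 ^ m) ^ a‖ ≤ 1 / ((m : ℝ) * √m) := by
  rw [norm_mul, ← pow_mul, norm_levelRoot_three_pow, mul_one, norm_pow, norm_div, norm_one,
    Complex.norm_natCast]
  exact one_div_pow_le_one_div_mul_sqrt hm hl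

theorem multipleLConverges_singleton {l : ℕ} (hl : 2 ≤ l) (a : ZMod 3) :
    MultipleLConverges 3 [(l, a)] := by
  simp only [MultipleLConverges, funext (multipleLPartial_singleton l a)]
  exact exists_tendsto_sum_Ioo_of_norm_le (C := 1) fun m hm => by
    rw [one_mul]; exact norm_one_div_pow_mul_levelRoot_le hm hl _

theorem zmod_three_eq_one_or_two {a : ZMod 3} (ha : a ≠ 0) : a = 1 ∨ a = 2 := by
  revert a
  decide

/-- With m outside, the inner sum over m < u < M is a difference of two initial sums. This gives a
product of two convergent sums minus an absolutely convergent one, since the initial sums in u are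
bounded by Dirichlet's test. -/
theorem multipleLConverges_pair {l : ℕ} (hl : 2 ≤ l) {a : ZMod 3} (ha : a ≠ 0) (b : ZMod 3) :
    MultipleLConverges 3 [(1, a), (l, b)] := by
  set w : ℕ → ℂ := fun m => (1 / (m : ℂ)) ^ l * (levelRoot 3 ^ m) ^ b.val with hw
  set v : ℕ → ℂ := fun u => (1 / (u : ℂ)) * (levelRoot 3 ^ u) ^ a.val with hv
  have hω := levelRoot_three_sq
  have hω3 := levelRoot_three_pow_three
  obtain ⟨p, hp⟩ := tendsto_sum_div_of_periodic_three (fun u => (levelRoot 3 ^ u) ^ a.val)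
    (fun u => by rw [pow_add, hω3, mul_one])
    (by
      have := zmod_three_eq_one_or_two ha
      rcases this with rfl | rfl
      · have : ZMod.val (1 : ZMod 3) = 1 := rfl
        rw [this]; linear_combination hω
      · have : ZMod.val (2 : ZMod 3) = 2 := rfl
        rw [this]; linear_combination hω + levelRoot 3 * hω3)
  have hp' : Tendsto (fun M => ∑ u ∈ Finset.Ioo 0 M, v u) atTop (𝓝 p) := by
    refine hp.congr fun M => Finset.sum_congr rfl fun u _ => ?_
    rw [Complex.real_smul, hv]
    push_cast
    rfl
  obtain ⟨C, hC0, hC, -⟩ := exists_norm_sum_Ioo_le hp'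
  have hwb : ∀ m, 0 < m → ‖w m‖ ≤ 1 / ((m : ℝ) * √m) := fun m hm =>
    norm_one_div_pow_mul_levelRoot_le hm hl _
  obtain ⟨t, ht⟩ := exists_tendsto_sum_Ioo_of_norm_le (f := w) (C := 1)
    fun m hm => (hwb m hm).trans_eq (one_mul _).symm
  obtain ⟨r, hr⟩ := exists_tendsto_sum_Ioo_of_norm_le
    (f := fun m => w m * ∑ u ∈ Finset.Ioo 0 (m + 1), v u) (C := C) fun m hm => by
      rw [norm_mul, mul_comm C]
      exact mul_le_mul (hwb m hm) (hC _) (norm_nonneg _) (by positivity)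
  refine ⟨t * p - r, ((ht.mul hp').sub hr).congr fun M => ?_⟩
  rw [multipleLPartial_pair, Finset.sum_mul, ← Finset.sum_sub_distrib]
  refine Finset.sum_congr rfl fun m hm => ?_
  rw [← Finset.mul_sum, sum_Ioo_eq_sub _ (Finset.mem_Ioo.1 hm).2]
  exact (mul_sub _ _ _).symm

theorem MultipleLConverges.tendsto {N : ℕ} {s : List (ℕ × ZMod N)} (h : MultipleLConverges N s) :
    Tendsto (multipleLPartial N s) atTop (𝓝 (multipleL N s)) :=
  tendsto_nhds_limUnder h

theorem LevelZetaConverges.tendsto {N : ℕ} {s : List (ℕ × ZMod N)} (h : LevelZetaConverges N s) :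
    Tendsto (levelZetaPartial N s) atTop (𝓝 (levelZeta N s)) :=
  tendsto_nhds_limUnder h

theorem multipleL_singleton_zero {l : ℕ} (hl : 2 ≤ l) : multipleL 3 [(l, 0)] = riemannZeta l := by
  refine tendsto_nhds_unique (multipleLConverges_singleton hl 0).tendsto ?_
  rw [zeta_nat_eq_tsum_of_gt_one hl]
  refine (tendsto_sum_Ioo_of_summable (f := fun n : ℕ => 1 / (n : ℂ) ^ l)
    (by simp [show l ≠ 0 by omega]) (by
      simpa using (Complex.summable_one_div_nat_cpow (p := l)).2 (by simpa using show 1 < l by omega))).congr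
    fun M => ?_
  rw [multipleLPartial_singleton]
  exact Finset.sum_congr rfl fun m _ => by simp

/-! ### Fourier expansion modulo 3 -/

/-- Fourier inversion on ℤ/3, with ω² replaced by -(1 + ω). -/
theorem residueIndicator_fourier (m : ℕ) :
    (residueIndicator 0 m : ℂ) = (1 + levelRoot 3 ^ m + (levelRoot 3 ^ m) ^ 2) / 3 ∧
    (residueIndicator 1 m : ℂ) =
      (1 - (1 + levelRoot 3) * levelRoot 3 ^ m + levelRoot 3 * (levelRoot 3 ^ m) ^ 2) / 3 ∧
    (residueIndicator 2 m : ℂ) =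
      (1 + levelRoot 3 * levelRoot 3 ^ m - (1 + levelRoot 3) * (levelRoot 3 ^ m) ^ 2) / 3 := by
  have hω := levelRoot_three_sq
  have hω3 := levelRoot_three_pow_three
  obtain ⟨q, r, hr, rfl⟩ : ∃ q r, r < 3 ∧ m = 3 * q + r :=
    ⟨m / 3, m % 3, Nat.mod_lt _ (by norm_num), (Nat.div_add_mod m 3).symm⟩
  have h30 : (3 : ZMod 3) = 0 := rfl
  have e1 : (1 : ZMod 3) ≠ 2 := by decide
  have e2 : (2 : ZMod 3) ≠ 0 := by decide
  have hpow : levelRoot 3 ^ (3 * q + r) = levelRoot 3 ^ r := by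
    rw [pow_add, pow_mul, hω3, one_pow, one_mul]
  rw [hpow]
  generalize levelRoot 3 = ω at *
  have hval : ∀ c : ZMod 3, residueIndicator c (3 * q + r) =
      if (r : ZMod 3) = c then 1 else 0 := by
    intro c; simp [residueIndicator, h30]
  simp only [hval]
  interval_cases r
  · simp only [Nat.cast_zero, e2.symm, zero_ne_one, if_true, if_false, Complex.ofReal_zero,
      Complex.ofReal_one]
    refine ⟨?_, ?_, ?_⟩
    · ring
    · ring
    · ring
  · simp only [Nat.cast_one, e1, one_ne_zero, if_true, if_false, Complex.ofReal_zero,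
      Complex.ofReal_one]
    refine ⟨?_, ?_, ?_⟩
    · linear_combination -hω / 3
    · linear_combination hω / 3 - hω3 / 3
    · linear_combination hω3 / 3
  · simp only [Nat.cast_ofNat, e1.symm, e2, if_true, if_false, Complex.ofReal_zero,
      Complex.ofReal_one]
    refine ⟨?_, ?_, ?_⟩
    · linear_combination -hω / 3 - ω / 3 * hω3
    · linear_combination (1 - ω ^ 2) / 3 * hω3
    · linear_combination hω / 3 + (ω ^ 2 + ω - 1) / 3 * hω3

/-- The trivial character in u cancels from the difference of indicators, so only conditionally
convergent L-values with a nonzero first twist arise. -/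
theorem residueIndicator_mul_residueDiff_fourier {p : ZMod 3} (hp : p ≠ 0) (m u : ℕ) :
    18 * ((residueIndicator (2 * p) m : ℂ) * (residueDiff (2 * p) u : ℂ)) =
      (2 * levelRoot 3 + 4) * ((levelRoot 3 ^ u) ^ p.val -
        (levelRoot 3 ^ m) ^ (2 * p).val * (levelRoot 3 ^ u) ^ (2 * p).val) +
      (2 * levelRoot 3 - 2) * ((levelRoot 3 ^ m) ^ p.val * (levelRoot 3 ^ u) ^ p.val -
        (levelRoot 3 ^ u) ^ (2 * p).val) +
      (4 * levelRoot 3 + 2) * ((levelRoot 3 ^ m) ^ p.val * (levelRoot 3 ^ u) ^ (2 * p).val -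
        (levelRoot 3 ^ m) ^ (2 * p).val * (levelRoot 3 ^ u) ^ p.val) := by
  obtain ⟨hm0, hm1, hm2⟩ := residueIndicator_fourier m
  obtain ⟨hu0, hu1, hu2⟩ := residueIndicator_fourier u
  have hω := levelRoot_three_sq
  have e4 : (2 : ZMod 3) * 2 = 1 := by decide
  have v1 : ZMod.val (1 : ZMod 3) = 1 := rfl
  have v2 : ZMod.val (2 : ZMod 3) = 2 := rfl
  have := zmod_three_eq_one_or_two hp
  rcases this with rfl | rfl
  · simp only [residueDiff, mul_one, e4, v1, v2, pow_one, Complex.ofReal_sub, hm2, hu0, hu1]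
    generalize levelRoot 3 ^ m = y
    generalize levelRoot 3 ^ u = x
    linear_combination 2 * (x * y - x * y ^ 2 - x ^ 2 * y + x ^ 2 * y ^ 2) * hω
  · simp only [residueDiff, mul_one, e4, v1, v2, pow_one, Complex.ofReal_sub, hm1, hu0, hu2]
    generalize levelRoot 3 ^ m = y
    generalize levelRoot 3 ^ u = x
    linear_combination 2 * (x * y - x * y ^ 2 - x ^ 2 * y + x ^ 2 * y ^ 2) * hω

theorem residueIndicator_two_mul_fourier {p : ZMod 3} (hp : p ≠ 0) (m : ℕ) :
    3 * (residueIndicator (2 * p) m : ℂ) = 1 + levelRoot 3 * (levelRoot 3 ^ m) ^ p.val -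
      (levelRoot 3 + 1) * (levelRoot 3 ^ m) ^ (2 * p).val := by
  obtain ⟨-, hm1, hm2⟩ := residueIndicator_fourier m
  have e4 : (2 : ZMod 3) * 2 = 1 := by decide
  have v1 : ZMod.val (1 : ZMod 3) = 1 := rfl
  have v2 : ZMod.val (2 : ZMod 3) = 2 := rfl
  have := zmod_three_eq_one_or_two hp
  rcases this with rfl | rfl
  · rw [mul_one, v1, v2, hm2]; ring
  · rw [e4, v1, v2, hm1]; ring

theorem twistedPartial_eq (K : ℕ) {p : ZMod 3} (hp : p ≠ 0) (M : ℕ) :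
    (twistedPartial K (2 * p) M : ℂ) =
      (2 * levelRoot 3 + 4) * (multipleLPartial 3 [(1, p), (K + 1, 0)] M -
        multipleLPartial 3 [(1, 2 * p), (K + 1, 2 * p)] M)
      + (2 * levelRoot 3 - 2) * (multipleLPartial 3 [(1, p), (K + 1, p)] M -
        multipleLPartial 3 [(1, 2 * p), (K + 1, 0)] M)
      + (4 * levelRoot 3 + 2) * (multipleLPartial 3 [(1, 2 * p), (K + 1, p)] M -
        multipleLPartial 3 [(1, p), (K + 1, 2 * p)] M)
      + (3 * ((K + 2 : ℕ) : ℂ) - 3) * multipleLPartial 3 [(K + 2, 0)] M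
      + (3 * ((K + 2 : ℕ) : ℂ) - 3) * levelRoot 3 * multipleLPartial 3 [(K + 2, p)] M
      - (3 * ((K + 2 : ℕ) : ℂ) - 3) * (levelRoot 3 + 1) *
        multipleLPartial 3 [(K + 2, 2 * p)] M := by
  simp only [multipleLPartial_pair, multipleLPartial_singleton, Finset.mul_sum,
    ← Finset.sum_add_distrib, ← Finset.sum_sub_distrib]
  simp only [twistedPartial, Complex.ofReal_sum]
  refine Finset.sum_congr rfl fun m _ => ?_
  have h1 := residueIndicator_two_mul_fourier hp m
  have h2 : (residueIndicator (2 * p) m : ℂ) * (18 * (1 / (m : ℂ)) ^ (K + 1) *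
      ∑ u ∈ Finset.Ioo m M, (residueDiff (2 * p) u : ℂ) * (1 / (u : ℂ))) =
      ∑ u ∈ Finset.Ioo m M, (1 / (m : ℂ)) ^ (K + 1) * (1 / (u : ℂ)) *
        (18 * ((residueIndicator (2 * p) m : ℂ) * (residueDiff (2 * p) u : ℂ))) := by
    simp only [Finset.mul_sum]
    exact Finset.sum_congr rfl fun u _ => by ring
  push_cast
  rw [mul_add, h2]
  have h3 : (residueIndicator (2 * p) m : ℂ) * (9 * ((K : ℂ) + 1) * (1 / (m : ℂ)) ^ (K + 2)) =
      3 * ((K : ℂ) + 1) * (1 / (m : ℂ)) ^ (K + 2) * (3 * (residueIndicator (2 * p) m : ℂ)) := by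
    ring
  rw [h3, h1]
  simp only [residueIndicator_mul_residueDiff_fourier hp, ZMod.val_zero, pow_zero]
  rw [add_sub_assoc, add_assoc, add_sub_assoc]
  congr 1
  · exact Finset.sum_congr rfl fun u _ => by ring
  · ring

/-! ### Passage to the limit -/

/-- Both formulas are the cases p = 1 and p = 2, as 2 · 2 = 1 modulo 3. The earlier lemmas apply
with c = 2p, so that 2c = p. -/
theorem weighted_sum_formula {k : ℕ} (hk : 3 ≤ k) {p : ZMod 3} (hp : p ≠ 0) :
    ∑ j ∈ Finset.Icc 2 (k - 1), (2 : ℂ) ^ j * ((levelZeta 3 [(j, p), (k - j, 2 * p)] : ℝ) : ℂ) =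
      (2 * levelRoot 3 + 4) * (multipleL 3 [(1, p), (k - 1, 0)] -
        multipleL 3 [(1, 2 * p), (k - 1, 2 * p)])
      + (2 * levelRoot 3 - 2) * (multipleL 3 [(1, p), (k - 1, p)] -
        multipleL 3 [(1, 2 * p), (k - 1, 0)])
      + (4 * levelRoot 3 + 2) * (multipleL 3 [(1, 2 * p), (k - 1, p)] -
        multipleL 3 [(1, p), (k - 1, 2 * p)])
      + (3 * (k : ℂ) - 3) * riemannZeta (k : ℂ)
      + (3 * (k : ℂ) - 3) * levelRoot 3 * multipleL 3 [(k, p)]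
      - (3 * (k : ℂ) - 3) * (levelRoot 3 + 1) * multipleL 3 [(k, 2 * p)] := by
  obtain ⟨K, rfl⟩ : ∃ K, k = K + 2 := ⟨k - 2, by omega⟩
  rw [show K + 2 - 1 = K + 1 by omega, ← multipleL_singleton_zero (by omega : 2 ≤ K + 2)]
  have h2p : 2 * p ≠ 0 := by revert p; decide
  have h4p : 2 * (2 * p) = p := by revert p; decide
  have hpair : ∀ a b : ZMod 3, a ≠ 0 → Tendsto (multipleLPartial 3 [(1, a), (K + 1, b)]) atTop
      (𝓝 (multipleL 3 [(1, a), (K + 1, b)])) := fun a b ha =>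
    (multipleLConverges_pair (by omega) ha b).tendsto
  have hsing : ∀ a : ZMod 3, Tendsto (multipleLPartial 3 [(K + 2, a)]) atTop
      (𝓝 (multipleL 3 [(K + 2, a)])) := fun a => (multipleLConverges_singleton (by omega) a).tendsto
  have hR := (((((((hpair p 0 hp).sub (hpair _ (2 * p) h2p)).const_mul (2 * levelRoot 3 + 4)).add
    (((hpair p p hp).sub (hpair _ 0 h2p)).const_mul (2 * levelRoot 3 - 2))).add
    (((hpair _ p h2p).sub (hpair p (2 * p) hp)).const_mul (4 * levelRoot 3 + 2))).add
    ((hsing 0).const_mul (3 * ((K + 2 : ℕ) : ℂ) - 3))).add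
    ((hsing p).const_mul ((3 * ((K + 2 : ℕ) : ℂ) - 3) * levelRoot 3))).sub
    ((hsing (2 * p)).const_mul ((3 * ((K + 2 : ℕ) : ℂ) - 3) * (levelRoot 3 + 1)))
  have hL : Tendsto (fun M => ((∑ j ∈ Finset.Icc 2 (K + 1),
      (2 : ℝ) ^ j * levelZetaPartial 3 [(j, p), (K + 2 - j, 2 * p)] M : ℝ) : ℂ)) atTop
      (𝓝 ((∑ j ∈ Finset.Icc 2 (K + 1),
        (2 : ℝ) ^ j * levelZeta 3 [(j, p), (K + 2 - j, 2 * p)] : ℝ) : ℂ)) := by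
    refine (Complex.continuous_ofReal.tendsto _).comp (tendsto_finsetSum _ fun j hj => ?_)
    rw [Finset.mem_Icc] at hj
    exact ((levelZetaConverges_pair hj.1 (by omega) _ _).tendsto).const_mul _
  have hD := (Complex.continuous_ofReal.tendsto _).comp
    (tendsto_levelZetaPartial_sub_twistedPartial (by omega : 1 ≤ K) h2p)
  rw [h4p, Complex.ofReal_zero] at hD
  have hlim := tendsto_nhds_unique (hL.sub hD) (hR.congr fun M => by
    rw [← twistedPartial_eq K hp]
    simp only [Function.comp_apply, Complex.ofReal_sub]
    exact (sub_sub_cancel _ _).symm)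
  rw [sub_zero] at hlim
  rw [← hlim]
  push_cast
  rfl

theorem mainTheorem12 (k : ℕ) (hk : 3 ≤ k) (ω : ℂ) (hω : ω = levelRoot 3) :
    -- every series occurring in the two formulas converges
    ((∀ j ∈ Finset.Icc 2 (k - 1),
        LevelZetaConverges 3 [(j, 1), (k - j, 2)] ∧ LevelZetaConverges 3 [(j, 2), (k - j, 1)]) ∧
      (∀ a b : ZMod 3, a ≠ 0 → MultipleLConverges 3 [(1, a), (k - 1, b)]) ∧
      (∀ a : ZMod 3, MultipleLConverges 3 [(k, a)])) ∧
    -- the first weighted sum formula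
    ∑ j ∈ Finset.Icc 2 (k - 1), (2 : ℂ) ^ j * ((levelZeta 3 [(j, 1), (k - j, 2)] : ℝ) : ℂ) =
      (2 * ω + 4) * (multipleL 3 [(1, 1), (k - 1, 0)] - multipleL 3 [(1, 2), (k - 1, 2)])
      + (2 * ω - 2) * (multipleL 3 [(1, 1), (k - 1, 1)] - multipleL 3 [(1, 2), (k - 1, 0)])
      + (4 * ω + 2) * (multipleL 3 [(1, 2), (k - 1, 1)] - multipleL 3 [(1, 1), (k - 1, 2)])
      + (3 * (k : ℂ) - 3) * riemannZeta (k : ℂ)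
      + (3 * (k : ℂ) - 3) * ω * multipleL 3 [(k, 1)]
      - (3 * (k : ℂ) - 3) * (ω + 1) * multipleL 3 [(k, 2)] ∧
    -- the second weighted sum formula
    ∑ j ∈ Finset.Icc 2 (k - 1), (2 : ℂ) ^ j * ((levelZeta 3 [(j, 2), (k - j, 1)] : ℝ) : ℂ) =
      (2 * ω + 4) * (multipleL 3 [(1, 2), (k - 1, 0)] - multipleL 3 [(1, 1), (k - 1, 1)])
      + (2 * ω - 2) * (multipleL 3 [(1, 2), (k - 1, 2)] - multipleL 3 [(1, 1), (k - 1, 0)])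
      + (4 * ω + 2) * (multipleL 3 [(1, 1), (k - 1, 2)] - multipleL 3 [(1, 2), (k - 1, 1)])
      + (3 * (k : ℂ) - 3) * riemannZeta (k : ℂ)
      + (3 * (k : ℂ) - 3) * ω * multipleL 3 [(k, 2)]
      - (3 * (k : ℂ) - 3) * (ω + 1) * multipleL 3 [(k, 1)] := by
  subst hω
  have e4 : (2 : ZMod 3) * 2 = 1 := by decide
  have e2 : (2 : ZMod 3) ≠ 0 := by decide
  refine ⟨⟨fun j hj => ?_, fun a b ha => multipleLConverges_pair (by omega) ha b,
    fun a => multipleLConverges_singleton (by omega) a⟩, ?_, ?_⟩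
  · rw [Finset.mem_Icc] at hj
    exact ⟨levelZetaConverges_pair hj.1 (by omega) _ _,
      levelZetaConverges_pair hj.1 (by omega) _ _⟩
  · simpa only [mul_one] using weighted_sum_formula hk (one_ne_zero (α := ZMod 3))
  · simpa only [e4] using weighted_sum_formula hk e2
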